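/- There is a universal constant $c>0$ such that the following holds. Let $d>2$, $D$ and $n\ge 1$ be integers, let $\mathcal U_d$ be the uniform distribution on $[0,1]^d$, and let $\|\cdot\|$ be the Euclidean norm. Let $\mathcal F$ be a set of $1$-Lipschitz functions $[0,1]^D\to\mathbb R$, and for probability measures $P,Q$ on $[0,1]^D$ put $\mathsf d_{\mathcal F}(P,Q)=\sup_{f\in\mathcal F}|\mathbb E_P f-\mathbb E_Q f|$. Let $\mathcal G$ be a set of $L_{\mathcal G}$-Lipschitz maps $[0,1]^d\to[0,1]^D$ and $\mathcal H$ a nonempty set of $L_{\mathcal H}$-Lipschitz maps $[0,1]^D\to[0,1]^d$, with finite constants $L_{\mathcal G},L_{\mathcal H}\ge 0$. For $q\ge1$ define the left-inverse penalty $$\mathrm{pen}_{\mathcal H}(g)=\inf_{h\in\mathcal H}\int_{[0,1]^d}\|h(g(u))-u\|^q\,du .$$ Let $P^*$ be a probability measure on $[0,1]^D$ satisfying assumption $\mathsf A(L^*,\sigma^*)$ for some $L^*,\sigma^*\ge 0$: there is an $L^*$-Lipschitz map $g^*:[0,1]^d\to[0,1]^D$ with $\mathsf W_1(g^*\sharp\,\mathcal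 U_d,P^*)\le\sigma^*$, where $\mathsf W_1$ is the Wasserstein-1 distance for the Euclidean metric. Let $X_1,\dots,X_n$ be i.i.d. with law $P^*$ and let $\widehat P_n=\frac1n\sum_{i=1}^n\delta_{X_i}$. Let $\lambda>0$ and let $\widehat g_n$ be a left-inverse-penalized empirical risk minimizer (LIPERM), i.e. a data-dependent generator that almost surely satisfies $$\widehat g_n\in\operatorname*{arg\,min}_{g\in\mathcal G}\big\{\mathsf d_{\mathcal F}(g\sharp\,\mathcal U_d,\widehat P_n)+\lambda\,\mathrm{pen}_{\mathcal H}(g)\big\},$$ and for which $\mathsf d_{\mathcal F}(\widehat g_n\sharp\,\mathcal U_d,P^*)$ is a random variable, i.e. measurable. Then this random variable is integrable and $$\mathbb E\big[\mathsf d_{\mathcal F}(\widehat g_n\sharp\,\mathcal U_d,P^*)\big]\le\inf_{g\in\mathcal G}\big\{\mathsf d_{\mathcal F}(g\sharp\,\mathcal U_d,P^*)+\lambda\,\mathrm{pen}_{\mathcal H}(g)\big\}+4\sigma^*+c\,L^*\sqrt d\;n^{-1/d}.$$ -/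

import Mathlib

open MeasureTheory ProbabilityTheory
open scoped NNReal ENNReal

noncomputable section

/-- The unit hypercube `[0,1]^m`, a subspace of Euclidean space (so with the Euclidean distance
and the Borel sigma-algebra). -/
abbrev Cube (m : ℕ) : Type :=
  ↥{x : EuclideanSpace ℝ (Fin m) | ∀ i, x i ∈ Set.Icc (0 : ℝ) 1}

/-- The uniform distribution on `[0,1]^m`: Lebesgue measure restricted to the cube. -/
def uniformCube (m : ℕ) : Measure (Cube m) :=
  Measure.comap Subtype.val (volume : Measure (EuclideanSpace ℝ (Fin m)))

/-- The set of couplings of `P` and `Q`: measures on the product with marginals `P` and `Q`. -/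
def couplings {E : Type*} [MeasurableSpace E] (P Q : Measure E) : Set (Measure (E × E)) :=
  {π | π.map Prod.fst = P ∧ π.map Prod.snd = Q}

/-- The Wasserstein-1 distance: infimum over couplings of the expected distance. -/
def wasserstein1 {E : Type*} [MeasurableSpace E] [PseudoEMetricSpace E] (P Q : Measure E) :
    ℝ≥0∞ :=
  ⨅ π ∈ couplings P Q, ∫⁻ z, edist z.1 z.2 ∂π

/-- The integral probability metric attached to a set `F` of test functions,
`sup_{f ∈ F} |E_P f - E_Q f|`. (The supremum is finite when the functions in `F` share a Lipschitz
constant on a cube; it is `0` for empty `F`.) -/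
def ipm {E : Type*} [MeasurableSpace E] (F : Set (E → ℝ)) (P Q : Measure E) : ℝ :=
  ⨆ f : F, |(∫ x, f.1 x ∂P) - ∫ x, f.1 x ∂Q|

/-- The empirical distribution `(1/n) ∑ δ_{x i}` of a sample. -/
def empiricalMeasure {E : Type*} [MeasurableSpace E] {n : ℕ} (x : Fin n → E) : Measure E :=
  (n : ℝ≥0∞)⁻¹ • ∑ i, Measure.dirac (x i)

/-- The left-inverse penalty `inf_{h ∈ H} ∫_{[0,1]^d} ‖h (g u) - u‖^q du`. -/
def leftInvPenalty {d D : ℕ} (q : ℝ) (H : Set (Cube D → Cube d)) (g : Cube d → Cube D) : ℝ :=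
  ⨅ h : H, ∫ u, ‖(h.1 (g u) : EuclideanSpace ℝ (Fin d)) - u‖ ^ q ∂(uniformCube d)

/-- The penalized risk `d_F(g♯U_d, Q) + lam * pen_H(g)` of a generator `g`, relative to a target
distribution `Q`. -/
def penalizedRisk {d D : ℕ} (q lam : ℝ) (F : Set (Cube D → ℝ)) (H : Set (Cube D → Cube d))
    (Q : Measure (Cube D)) (g : Cube d → Cube D) : ℝ :=
  ipm F ((uniformCube d).map g) Q + lam * leftInvPenalty q H g

/-- `g` is a left-inverse-penalized empirical risk minimizer over `G` for the sample `x`. -/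
def IsLIPERM {d D n : ℕ} (q lam : ℝ) (F : Set (Cube D → ℝ)) (G : Set (Cube d → Cube D))
    (H : Set (Cube D → Cube d)) (x : Fin n → Cube D) (g : Cube d → Cube D) : Prop :=
  g ∈ G ∧ IsMinOn (penalizedRisk q lam F H (empiricalMeasure x)) G g

/-- The assumption `A(L, σ)` on the data distribution: `P` is within Wasserstein-1 distance `σ` of
the image of the uniform distribution under an `L`-Lipschitz map `[0,1]^d → [0,1]^D`. -/
def AssumptionA {D : ℕ} (d : ℕ) (L σ : ℝ≥0) (P : Measure (Cube D)) : Prop :=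
  ∃ g : Cube d → Cube D, LipschitzWith L g ∧ wasserstein1 ((uniformCube d).map g) P ≤ (σ : ℝ≥0∞)

end

noncomputable section

/-! The argument is an oracle inequality followed by a bound on the empirical error. Comparing
`ghat` with any competitor `g` under the empirical risk and using the triangle inequality for `ipm`
twice costs `2 * ipm F (empiricalMeasure x) P`; the nonnegative penalty of `ghat` is dropped
(`ipm_le_penalizedRisk_add`).

It remains to bound the mean of `ipm F (empiricalMeasure x) P` by `2σ + 12 L √d n^(-1/d)`. Sampling
i.i.d. pairs from a near-optimal coupling replaces `P` by `g♯U_d` at cost `2σ`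
(`integral_ipm_empiricalMeasure_le_of_coupling`). For the pushforward, each `f ∘ g` is `L`-Lipschitz
on `[0,1]^d`, so the rate depends on `d` and not on `D`. Dyadic chaining bounds all these functions
at once by weighted deviations of cell masses (`abs_integral_sub_integral_le_dyadicDiscrepancy`). At
scale `j` the expected deviations sum to at most `√(2^(dj)/n)`, with weight `2^(-j)`. For `d > 2`
the resulting geometric sum is dominated by its finest scale, chosen so that `2^(dJ)` is comparable
to `n`. -/

instance compactSpace_cube (m : ℕ) : CompactSpace (Cube m) := by
  refine isCompact_iff_compactSpace.mp (Metric.isCompact_of_isClosed_isBounded ?_ ?_)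
  · have h : {x : EuclideanSpace ℝ (Fin m) | ∀ i, x i ∈ Set.Icc (0 : ℝ) 1} =
        ⋂ i, (fun x : EuclideanSpace ℝ (Fin m) => x i) ⁻¹' Set.Icc 0 1 := by
      ext x; simp
    rw [h]
    exact isClosed_iInter fun i => isClosed_Icc.preimage (by fun_prop)
  · refine isBounded_iff_forall_norm_le.mpr ⟨√m, fun x hx => ?_⟩
    rw [EuclideanSpace.norm_eq]
    refine Real.sqrt_le_sqrt ?_
    calc ∑ i, ‖x i‖ ^ 2 ≤ ∑ _i : Fin m, (1 : ℝ) := by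
          refine Finset.sum_le_sum fun i _ => ?_
          rw [Real.norm_of_nonneg (hx i).1]
          exact pow_le_one₀ (hx i).1 (hx i).2
      _ = m := by simp

lemma measurableSet_cube (m : ℕ) :
    MeasurableSet {x : EuclideanSpace ℝ (Fin m) | ∀ i, x i ∈ Set.Icc (0 : ℝ) 1} :=
  (isCompact_iff_compactSpace.mpr (compactSpace_cube m)).isClosed.measurableSet

instance isProbabilityMeasure_uniformCube (m : ℕ) : IsProbabilityMeasure (uniformCube m) := by
  constructor
  have hs := measurableSet_cube m
  rw [uniformCube, (MeasurableEmbedding.subtype_coe hs).comap_apply, Set.image_univ,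
    Subtype.range_coe]
  have h : {x : EuclideanSpace ℝ (Fin m) | ∀ i, x i ∈ Set.Icc (0 : ℝ) 1} =
      WithLp.ofLp ⁻¹' Set.Icc (0 : Fin m → ℝ) 1 := by
    ext x
    simp [Pi.le_def, forall_and]
  rw [h, (PiLp.volume_preserving_ofLp (Fin m)).measure_preimage measurableSet_Icc.nullMeasurableSet,
    Real.volume_Icc_pi]
  simp

lemma dist_le_diam_univ {E : Type*} [MetricSpace E] [CompactSpace E] (x y : E) : dist x y ≤ Metric.diam (Set.univ : Set E) :=
  Metric.dist_le_diam_of_mem isCompact_univ.isBounded (Set.mem_univ _) (Set.mem_univ _)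

/-! ### Integral probability metrics of Lipschitz classes on compact spaces -/

section IPM

variable {E : Type*} [MeasurableSpace E]

instance isProbabilityMeasure_empiricalMeasure {n : ℕ} [NeZero n] (x : Fin n → E) :
    IsProbabilityMeasure (empiricalMeasure x) := by
  constructor
  have : (n : ℝ≥0∞) ≠ 0 := by simpa using NeZero.ne n
  simp [empiricalMeasure, ENNReal.inv_mul_cancel this]

lemma integral_empiricalMeasure {n : ℕ} (x : Fin n → E) {f : E → ℝ} (hf : StronglyMeasurable f) :
    ∫ y, f y ∂(empiricalMeasure x) = (n : ℝ)⁻¹ * ∑ i, f (x i) := by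
  rw [empiricalMeasure, integral_smul_measure, integral_finsetSum_measure]
  · simp [integral_dirac' _ _ hf]
  · intro i _
    exact integrable_dirac' hf (by simp)

lemma ipm_nonneg (F : Set (E → ℝ)) (P Q : Measure E) : 0 ≤ ipm F P Q :=
  Real.iSup_nonneg fun _ => abs_nonneg _

lemma ipm_le {F : Set (E → ℝ)} {P Q : Measure E} {a : ℝ} (ha : 0 ≤ a)
    (h : ∀ f ∈ F, |(∫ x, f x ∂P) - ∫ x, f x ∂Q| ≤ a) : ipm F P Q ≤ a :=
  Real.iSup_le (fun f => h f.1 f.2) ha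

variable [MetricSpace E] [BorelSpace E]

lemma ipm_empiricalMeasure_le {F : Set (E → ℝ)} (hF : ∀ f ∈ F, LipschitzWith 1 f) {n : ℕ}
    (x y : Fin n → E) :
    ipm F (empiricalMeasure x) (empiricalMeasure y) ≤ (n : ℝ)⁻¹ * ∑ i, dist (x i) (y i) := by
  refine ipm_le (mul_nonneg (by positivity) (Finset.sum_nonneg fun _ _ => dist_nonneg))
    fun f hf => ?_
  have hm := (hF f hf).continuous.stronglyMeasurable
  rw [integral_empiricalMeasure x hm, integral_empiricalMeasure y hm, ← mul_sub,
    ← Finset.sum_sub_distrib, abs_mul, abs_of_nonneg (by positivity : (0 : ℝ) ≤ (n : ℝ)⁻¹)]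
  gcongr
  refine (Finset.abs_sum_le_sum_abs _ _).trans (Finset.sum_le_sum fun i _ => ?_)
  simpa [Real.dist_eq] using (hF f hf).dist_le_mul (x i) (y i)

variable [CompactSpace E]

lemma Continuous.integrable_of_compactSpace {f : E → ℝ} (hf : Continuous f) (P : Measure E)
    [IsFiniteMeasure P] : Integrable f P :=
  hf.integrable_of_hasCompactSupport (HasCompactSupport.of_compactSpace f)

lemma abs_integral_sub_le_integral_abs {P : Measure E} [IsProbabilityMeasure P] {f : E → ℝ}
    (hf : Continuous f) {a C : ℝ} (h : ∀ x, |f x - a| ≤ C) : |(∫ x, f x ∂P) - a| ≤ C := by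
  have hi := hf.integrable_of_compactSpace P
  have h1 : (∫ x, f x ∂P) - a = ∫ x, (f x - a) ∂P := by
    rw [integral_sub hi (integrable_const _)]; simp
  rw [h1]
  have := norm_integral_le_of_norm_le_const (μ := P) (f := fun x => f x - a) (C := C)
    (Filter.Eventually.of_forall h)
  simpa using this

lemma abs_integral_sub_integral_le_of_lipschitz {P Q : Measure E} [IsProbabilityMeasure P]
    [IsProbabilityMeasure Q] {f : E → ℝ} (hf : LipschitzWith 1 f) :
    |(∫ x, f x ∂P) - ∫ x, f x ∂Q| ≤ Metric.diam (Set.univ : Set E) := by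
  refine abs_integral_sub_le_integral_abs hf.continuous fun x => ?_
  rw [abs_sub_comm]
  refine abs_integral_sub_le_integral_abs hf.continuous fun y => ?_
  have := hf.dist_le_mul y x
  rw [Real.dist_eq] at this
  simpa using this.trans (by simpa using dist_le_diam_univ y x)

lemma bddAbove_ipm {F : Set (E → ℝ)} (hF : ∀ f ∈ F, LipschitzWith 1 f) (P Q : Measure E)
    [IsProbabilityMeasure P] [IsProbabilityMeasure Q] :
    BddAbove (Set.range fun f : F => |(∫ x, f.1 x ∂P) - ∫ x, f.1 x ∂Q|) := by
  refine ⟨Metric.diam (Set.univ : Set E), ?_⟩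
  rintro _ ⟨f, rfl⟩
  exact abs_integral_sub_integral_le_of_lipschitz (hF f.1 f.2)

lemma abs_integral_sub_integral_le_ipm {F : Set (E → ℝ)} (hF : ∀ f ∈ F, LipschitzWith 1 f)
    (P Q : Measure E) [IsProbabilityMeasure P] [IsProbabilityMeasure Q] {f : E → ℝ} (hf : f ∈ F) :
    |(∫ x, f x ∂P) - ∫ x, f x ∂Q| ≤ ipm F P Q :=
  le_ciSup (bddAbove_ipm hF P Q) (⟨f, hf⟩ : F)

lemma ipm_triangle {F : Set (E → ℝ)} (hF : ∀ f ∈ F, LipschitzWith 1 f) (P Q R : Measure E)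
    [IsProbabilityMeasure P] [IsProbabilityMeasure Q] [IsProbabilityMeasure R] :
    ipm F P R ≤ ipm F P Q + ipm F Q R := by
  refine ipm_le (add_nonneg (ipm_nonneg _ _ _) (ipm_nonneg _ _ _)) fun f hf => ?_
  exact (abs_sub_le _ (∫ x, f x ∂Q) _).trans
    (add_le_add (abs_integral_sub_integral_le_ipm hF P Q hf)
      (abs_integral_sub_integral_le_ipm hF Q R hf))

lemma ipm_le_diam {F : Set (E → ℝ)} (hF : ∀ f ∈ F, LipschitzWith 1 f) (P Q : Measure E)
    [IsProbabilityMeasure P] [IsProbabilityMeasure Q] :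
    ipm F P Q ≤ Metric.diam (Set.univ : Set E) :=
  ipm_le Metric.diam_nonneg fun f hf => abs_integral_sub_integral_le_of_lipschitz (hF f hf)

/-- The easy half of Kantorovich duality: integrate `|f z.1 - f z.2| ≤ dist z.1 z.2` against the
coupling. -/
lemma ipm_le_integral_dist {F : Set (E → ℝ)} (hF : ∀ f ∈ F, LipschitzWith 1 f) {P Q : Measure E}
    {π : Measure (E × E)} [IsProbabilityMeasure π] (hπ : π ∈ couplings P Q) :
    ipm F P Q ≤ ∫ z, dist z.1 z.2 ∂π := by
  refine ipm_le (integral_nonneg fun _ => dist_nonneg) fun f hf => ?_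
  have hc := (hF f hf).continuous
  rw [← hπ.1, ← hπ.2, integral_map (by fun_prop) hc.aestronglyMeasurable,
    integral_map (by fun_prop) hc.aestronglyMeasurable,
    ← integral_sub ((by fun_prop : Continuous fun z : E × E => f z.1).integrable_of_compactSpace π)
      ((by fun_prop : Continuous fun z : E × E => f z.2).integrable_of_compactSpace π)]
  refine (abs_integral_le_integral_abs).trans (integral_mono ?_ ?_ fun z => ?_)
  · exact (by fun_prop : Continuous fun z : E × E => |f z.1 - f z.2|).integrable_of_compactSpace π
  · exact (by fun_prop : Continuous fun z : E × E => dist z.1 z.2).integrable_of_compactSpace π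
  · simpa [Real.dist_eq] using (hF f hf).dist_le_mul z.1 z.2

/-- Settles measurability of a supremum over a possibly uncountable `F`: as a function of the sample
it is 1-Lipschitz for the sup distance, hence also integrable on the compact sample space. -/
lemma continuous_ipm_empiricalMeasure {F : Set (E → ℝ)} (hF : ∀ f ∈ F, LipschitzWith 1 f)
    {n : ℕ} [NeZero n] (P : Measure E) [IsProbabilityMeasure P] :
    Continuous fun x : Fin n → E => ipm F (empiricalMeasure x) P := by
  refine (LipschitzWith.of_le_add fun x y => ?_).continuous
  refine (ipm_triangle hF _ (empiricalMeasure y) _).trans ?_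
  rw [add_comm]
  gcongr
  refine (ipm_empiricalMeasure_le hF x y).trans ?_
  have hn : (n : ℝ) ≠ 0 := by simpa using NeZero.ne n
  calc (n : ℝ)⁻¹ * ∑ i, dist (x i) (y i) ≤ (n : ℝ)⁻¹ * ∑ _i : Fin n, dist x y := by
        gcongr with i
        exact dist_le_pi_dist x y i
    _ = dist x y := by simp [hn]

end IPM

/-! ### Dyadic chaining on the cube -/

/-- The index of the dyadic cell of side `2⁻ʲ` that contains `u`. -/
def dyadicIndex {d : ℕ} (j : ℕ) (u : Cube d) (i : Fin d) : ℕ :=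
  min ⌊(2 : ℝ) ^ j * u.1 i⌋₊ (2 ^ j - 1)

/-- The lower corner of a dyadic cell of side `2⁻ʲ`. -/
def dyadicCorner {d : ℕ} (j : ℕ) (Q : Fin d → ℕ) : Cube d :=
  ⟨WithLp.toLp 2 fun i => min ((Q i : ℝ) / 2 ^ j) 1, fun _ =>
    ⟨le_min (by positivity) zero_le_one, min_le_right _ _⟩⟩

/-- The indices of the dyadic cells of side `2⁻ʲ`. -/
def dyadicIndices (d j : ℕ) : Finset (Fin d → ℕ) :=
  Fintype.piFinset fun _ => Finset.range (2 ^ j)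

/-- The dyadic cell of side `2⁻ʲ` with a given index. -/
def dyadicCell {d : ℕ} (j : ℕ) (Q : Fin d → ℕ) : Set (Cube d) :=
  {u | dyadicIndex j u = Q}

section

variable {d : ℕ}

lemma card_dyadicIndices (d j : ℕ) : (dyadicIndices d j).card = (2 ^ d) ^ j := by
  simp [dyadicIndices, ← pow_mul, mul_comm]

lemma dyadicIndex_mem (j : ℕ) (u : Cube d) : dyadicIndex j u ∈ dyadicIndices d j := by
  have : 0 < 2 ^ j := by positivity
  simp only [dyadicIndices, Fintype.mem_piFinset, Finset.mem_range, dyadicIndex]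
  omega

/-- Nestedness of the cells, which makes chaining possible. The cap at `2 ^ j - 1`, which puts the
face `u i = 1` in the last cell, is compatible with halving. -/
lemma dyadicIndex_succ_div_two (j : ℕ) (u : Cube d) (i : Fin d) :
    dyadicIndex (j + 1) u i / 2 = dyadicIndex j u i := by
  have h : ⌊(2 : ℝ) ^ j * u.1 i⌋₊ = ⌊(2 : ℝ) ^ (j + 1) * u.1 i⌋₊ / 2 := by
    rw [← Nat.floor_div_natCast]
    congr 1
    push_cast
    ring
  have h1 : 0 < 2 ^ j := by positivity
  have h2 : 2 ^ (j + 1) = 2 * 2 ^ j := by ring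
  simp only [dyadicIndex, h]
  omega

lemma measurable_dyadicIndex (j : ℕ) : Measurable (dyadicIndex j : Cube d → Fin d → ℕ) := by
  refine measurable_pi_lambda _ fun i => Measurable.min ?_ measurable_const
  exact Nat.measurable_floor.comp (by fun_prop)

lemma measurableSet_dyadicCell (j : ℕ) (Q : Fin d → ℕ) : MeasurableSet (dyadicCell j Q) :=
  measurable_dyadicIndex j (measurableSet_singleton Q)

lemma dist_cube_le {u v : Cube d} {r : ℝ} (hr : 0 ≤ r) (h : ∀ i, |u.1 i - v.1 i| ≤ r) :
    dist u v ≤ √d * r := by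
  rw [Subtype.dist_eq, EuclideanSpace.dist_eq]
  refine Real.sqrt_le_iff.mpr ⟨by positivity, ?_⟩
  calc ∑ i, dist (u.1 i) (v.1 i) ^ 2 ≤ ∑ _i : Fin d, r ^ 2 := by
        refine Finset.sum_le_sum fun i _ => pow_le_pow_left₀ dist_nonneg ?_ 2
        simpa [Real.dist_eq] using h i
    _ = (√d * r) ^ 2 := by simp [mul_pow]

lemma dist_dyadicCorner_dyadicIndex_le (j : ℕ) (u : Cube d) :
    dist u (dyadicCorner j (dyadicIndex j u)) ≤ √d * (1 / 2) ^ j := by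
  refine dist_cube_le (by positivity) fun i => ?_
  have h2 : (0 : ℝ) < 2 ^ j := by positivity
  obtain ⟨h0, h1⟩ := u.2 i
  have hlow : (dyadicIndex j u i : ℝ) ≤ 2 ^ j * u.1 i :=
    (Nat.cast_le.mpr (min_le_left _ _)).trans (Nat.floor_le (by positivity))
  have hup : 2 ^ j * u.1 i ≤ (dyadicIndex j u i : ℝ) + 1 := by
    simp only [dyadicIndex]
    rcases min_choice ⌊(2 : ℝ) ^ j * u.1 i⌋₊ (2 ^ j - 1) with h | h <;> rw [h]
    · exact (Nat.lt_floor_add_one _).le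
    · rw [Nat.cast_sub Nat.one_le_two_pow]
      push_cast
      nlinarith
  have hd : (dyadicIndex j u i : ℝ) / 2 ^ j ≤ u.1 i := by
    rw [div_le_iff₀ h2]; linarith
  have hd' : u.1 i ≤ (dyadicIndex j u i : ℝ) / 2 ^ j + 1 / 2 ^ j := by
    rw [← add_div, le_div_iff₀ h2]; linarith
  simp only [dyadicCorner, one_div, inv_pow] at hd' ⊢
  rw [min_eq_left (hd.trans h1), abs_of_nonneg (by linarith)]
  linarith

lemma dist_dyadicCorner_succ_le (j : ℕ) (Q : Fin d → ℕ) :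
    dist (dyadicCorner (j + 1) Q) (dyadicCorner j fun i => Q i / 2) ≤ √d * (1 / 2) ^ (j + 1) := by
  refine dist_cube_le (by positivity) fun i => ?_
  have h2 : (0 : ℝ) < 2 ^ j := by positivity
  refine (abs_min_sub_min_le_max _ _ _ _).trans (max_le ?_ (by simp))
  -- The untruncated corners differ by the parity bit of `Q i` times `2⁻⁽ʲ⁺¹⁾`; truncation at `1`
  -- does not increase the difference.
  have h : ((Q i : ℕ) : ℝ) = 2 * ((Q i / 2 : ℕ) : ℝ) + ((Q i % 2 : ℕ) : ℝ) := by
    exact_mod_cast (Nat.div_add_mod (Q i) 2).symm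
  have hm : ((Q i % 2 : ℕ) : ℝ) ≤ 1 := by
    exact_mod_cast Nat.lt_succ_iff.mp (Nat.mod_lt _ two_pos)
  rw [h, show (2 * ((Q i / 2 : ℕ) : ℝ) + ((Q i % 2 : ℕ) : ℝ)) / 2 ^ (j + 1) -
    ((Q i / 2 : ℕ) : ℝ) / 2 ^ j = ((Q i % 2 : ℕ) : ℝ) * (1 / 2) ^ (j + 1) by
      rw [one_div, inv_pow]; field_simp; ring, abs_of_nonneg (by positivity)]
  exact mul_le_of_le_one_left (by positivity) hm

/-- The multiscale bound on the difference of two measures through the masses of dyadic cells. -/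
def dyadicDiscrepancy (J : ℕ) (P Q : Measure (Cube d)) : ℝ :=
  ∑ j ∈ Finset.range J, (1 / 2) ^ (j + 1) *
    ∑ A ∈ dyadicIndices d (j + 1), |P.real (dyadicCell (j + 1) A) - Q.real (dyadicCell (j + 1) A)|

lemma integral_comp_dyadicIndex (j : ℕ) (a : (Fin d → ℕ) → ℝ) (P : Measure (Cube d))
    [IsFiniteMeasure P] :
    Integrable (fun u => a (dyadicIndex j u)) P ∧
    ∫ u, a (dyadicIndex j u) ∂P = ∑ A ∈ dyadicIndices d j, P.real (dyadicCell j A) * a A := by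
  have h : (fun u => a (dyadicIndex j u)) = fun u => ∑ A ∈ dyadicIndices d j,
      (dyadicCell j A).indicator (fun _ => a A) u := by
    ext u
    rw [Finset.sum_eq_single (dyadicIndex j u)]
    · simp [dyadicCell]
    · intro A _ hA
      simp [dyadicCell, hA.symm]
    · exact fun h => (h (dyadicIndex_mem j u)).elim
  have hi : ∀ A ∈ dyadicIndices d j,
      Integrable ((dyadicCell j A).indicator fun _ => a A) P := fun A _ =>
    (integrable_const _).indicator (measurableSet_dyadicCell j A)
  rw [h]
  refine ⟨integrable_finsetSum _ hi, ?_⟩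
  rw [integral_finsetSum _ hi]
  refine Finset.sum_congr rfl fun A _ => ?_
  rw [integral_indicator_const _ (measurableSet_dyadicCell j A), smul_eq_mul]

/-- Telescoping over scales. At scale `0` there is one cell, so the two integrals agree. Each
refinement adds an increment that is constant on the finer cells and at most `K √d 2⁻⁽ʲ⁺¹⁾`, so its
two integrals differ only through the cell masses. -/
lemma abs_integral_dyadic_sub_le {K : ℝ≥0} {φ : Cube d → ℝ} (hφ : LipschitzWith K φ) (J : ℕ)
    (P Q : Measure (Cube d)) [IsProbabilityMeasure P] [IsProbabilityMeasure Q] :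
    |(∫ u, φ (dyadicCorner J (dyadicIndex J u)) ∂P) -
      ∫ u, φ (dyadicCorner J (dyadicIndex J u)) ∂Q| ≤ K * √d * dyadicDiscrepancy J P Q := by
  induction J with
  | zero =>
    have h : ∀ u : Cube d, dyadicIndex 0 u = 0 := fun u => by ext i; simp [dyadicIndex]
    simp [h, dyadicDiscrepancy]
  | succ J ih =>
    let a : (Fin d → ℕ) → ℝ := fun A =>
      φ (dyadicCorner (J + 1) A) - φ (dyadicCorner J fun i => A i / 2)
    have hsplit : ∀ u : Cube d, φ (dyadicCorner (J + 1) (dyadicIndex (J + 1) u)) =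
        φ (dyadicCorner J (dyadicIndex J u)) + a (dyadicIndex (J + 1) u) := fun u => by
      simp [a, dyadicIndex_succ_div_two]
    have ha : ∀ A, |a A| ≤ K * √d * (1 / 2) ^ (J + 1) := fun A => by
      have := hφ.dist_le_mul (dyadicCorner (J + 1) A) (dyadicCorner J fun i => A i / 2)
      rw [Real.dist_eq] at this
      refine this.trans ?_
      rw [mul_assoc]
      gcongr
      exact dist_dyadicCorner_succ_le J A
    have hb : |(∫ u, a (dyadicIndex (J + 1) u) ∂P) - ∫ u, a (dyadicIndex (J + 1) u) ∂Q| ≤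
        K * √d * ((1 / 2) ^ (J + 1) * ∑ A ∈ dyadicIndices d (J + 1),
          |P.real (dyadicCell (J + 1) A) - Q.real (dyadicCell (J + 1) A)|) := by
      rw [(integral_comp_dyadicIndex _ a P).2, (integral_comp_dyadicIndex _ a Q).2,
        ← Finset.sum_sub_distrib, ← mul_assoc, Finset.mul_sum]
      refine (Finset.abs_sum_le_sum_abs _ _).trans (Finset.sum_le_sum fun A _ => ?_)
      rw [← sub_mul, abs_mul, mul_comm]
      exact mul_le_mul_of_nonneg_right (ha A) (abs_nonneg _)
    simp only [hsplit]
    have hi := fun (P : Measure (Cube d)) [IsProbabilityMeasure P] =>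
      (integral_comp_dyadicIndex J (fun A => φ (dyadicCorner J A)) P).1
    have hi' := fun (P : Measure (Cube d)) [IsProbabilityMeasure P] =>
      (integral_comp_dyadicIndex (J + 1) a P).1
    rw [integral_add (hi P) (hi' P), integral_add (hi Q) (hi' Q), add_sub_add_comm,
      dyadicDiscrepancy, Finset.sum_range_succ, mul_add]
    exact (abs_add_le _ _).trans (add_le_add ih hb)

/-- Rounding to the corner at scale `J` costs `K √d 2⁻ᴶ` for each measure. The right side does not
depend on `φ`, so it survives the supremum over test functions. -/
lemma abs_integral_sub_integral_le_dyadicDiscrepancy {K : ℝ≥0} {φ : Cube d → ℝ}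
    (hφ : LipschitzWith K φ) (J : ℕ) (P Q : Measure (Cube d)) [IsProbabilityMeasure P]
    [IsProbabilityMeasure Q] :
    |(∫ u, φ u ∂P) - ∫ u, φ u ∂Q| ≤
      K * √d * (2 * (1 / 2) ^ J + dyadicDiscrepancy J P Q) := by
  have hP : ∀ (P : Measure (Cube d)) [IsProbabilityMeasure P], |(∫ u, φ u ∂P) -
      ∫ u, φ (dyadicCorner J (dyadicIndex J u)) ∂P| ≤ K * √d * (1 / 2) ^ J := by
    intro P _
    rw [← integral_sub (hφ.continuous.integrable_of_compactSpace P)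
      (integral_comp_dyadicIndex J (fun A => φ (dyadicCorner J A)) P).1]
    have := norm_integral_le_of_norm_le_const (μ := P)
      (f := fun u => φ u - φ (dyadicCorner J (dyadicIndex J u))) (C := K * √d * (1 / 2) ^ J)
      (Filter.Eventually.of_forall fun u => by
        rw [← dist_eq_norm, mul_assoc]
        refine (hφ.dist_le_mul _ _).trans ?_
        gcongr
        exact dist_dyadicCorner_dyadicIndex_le J u)
    simpa using this
  have h1 := abs_le.mp (hP P)
  have h2 := abs_le.mp (hP Q)
  have h3 := abs_le.mp (abs_integral_dyadic_sub_le hφ J P Q)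
  rw [mul_add, abs_le]
  constructor <;> linarith

end

/-! ### Fluctuations of empirical cell masses -/

section

variable {E : Type*} [MeasurableSpace E] {n : ℕ}

lemma empiricalMeasure_real_apply (x : Fin n → E) {s : Set E} (hs : MeasurableSet s) :
    (empiricalMeasure x).real s = (n : ℝ)⁻¹ * ∑ i, s.indicator 1 (x i) := by
  have h := integral_empiricalMeasure x
    (stronglyMeasurable_one.indicator hs : StronglyMeasurable (s.indicator (1 : E → ℝ)))
  rwa [integral_indicator_one hs] at h

lemma measurable_empiricalMeasure_real {s : Set E} (hs : MeasurableSet s) :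
    Measurable fun x : Fin n → E => (empiricalMeasure x).real s := by
  simp only [fun x : Fin n → E => empiricalMeasure_real_apply x hs]
  have : Measurable (s.indicator (1 : E → ℝ)) := measurable_one.indicator hs
  fun_prop

lemma sq_integral_abs_le {Ω : Type*} [MeasurableSpace Ω] {μ : Measure Ω} [IsProbabilityMeasure μ]
    {Z : Ω → ℝ} (hZ : MemLp Z 2 μ) : (∫ ω, |Z ω| ∂μ) ^ 2 ≤ ∫ ω, Z ω ^ 2 ∂μ := by
  have h := variance_nonneg |Z| μ
  rw [variance_eq_sub hZ.abs] at h
  simpa using h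

/-- The first absolute moment is at most the standard deviation, and an indicator of mean `p` has
variance at most `p`; independence makes the variances add. -/
lemma integral_abs_empiricalMeasure_real_sub_le [NeZero n] (P : Measure E)
    [IsProbabilityMeasure P] {s : Set E} (hs : MeasurableSet s) :
    ∫ x, |(empiricalMeasure x).real s - P.real s| ∂(Measure.pi fun _ : Fin n => P) ≤
      √(P.real s) / √n := by
  have hn : (n : ℝ) ≠ 0 := by simpa using NeZero.ne n
  have hmem : MemLp (s.indicator (1 : E → ℝ)) 2 P :=
    memLp_indicator_const 2 hs 1 (Or.inr (measure_ne_top _ _))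
  have hmean : ∫ y, s.indicator (1 : E → ℝ) y ∂P = P.real s := integral_indicator_one hs
  have hvar : Var[s.indicator (1 : E → ℝ); P] ≤ P.real s := by
    refine (variance_le_expectation_sq hmem.aestronglyMeasurable).trans_eq ?_
    rw [← hmean]
    congr 1
    ext y
    by_cases hy : y ∈ s <;> simp [hy]
  set S : (Fin n → E) → ℝ := ∑ i, fun x => s.indicator (1 : E → ℝ) (x i) with hS
  have hSi : ∀ i : Fin n, MemLp (fun x : Fin n → E => s.indicator (1 : E → ℝ) (x i)) 2
      (Measure.pi fun _ : Fin n => P) := fun i =>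
    hmem.comp_measurePreserving (measurePreserving_eval (fun _ : Fin n => P) i)
  have hSmem : MemLp S 2 (Measure.pi fun _ : Fin n => P) := by
    rw [hS, Finset.sum_fn]
    exact memLp_finsetSum _ fun i _ => hSi i
  have hSvar : Var[S; Measure.pi fun _ : Fin n => P] ≤ n * P.real s := by
    rw [hS, variance_sum_pi fun _ => hmem]
    simpa using mul_le_mul_of_nonneg_left hvar (Nat.cast_nonneg n)
  have hSmean : ∫ x, S x ∂(Measure.pi fun _ : Fin n => P) = n * P.real s := by
    simp only [hS, Finset.sum_apply]
    rw [integral_finsetSum _ fun i _ => (hSi i).integrable one_le_two]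
    have : ∀ i : Fin n, ∫ x : Fin n → E, s.indicator (1 : E → ℝ) (x i)
        ∂(Measure.pi fun _ : Fin n => P) = P.real s := fun i => by
      rw [← hmean]
      exact integral_comp_eval (μ := fun _ : Fin n => P) (i := i) hmem.aestronglyMeasurable
    simp [this]
  have hZ : ∀ x : Fin n → E, (empiricalMeasure x).real s - P.real s =
      (n : ℝ)⁻¹ * (S x - n * P.real s) := fun x => by
    rw [empiricalMeasure_real_apply x hs, hS, Finset.sum_apply]
    field_simp
  simp only [hZ, abs_mul]
  rw [integral_const_mul, abs_of_nonneg (by positivity), ← Real.sqrt_div' _ (Nat.cast_nonneg n)]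
  refine Real.le_sqrt_of_sq_le ?_
  rw [mul_pow]
  have h1 := sq_integral_abs_le (hSmem.sub (memLp_const (n * P.real s)))
  have h2 : ∫ x, (S x - n * P.real s) ^ 2 ∂(Measure.pi fun _ : Fin n => P) ≤ n * P.real s := by
    rw [variance_eq_integral hSmem.aestronglyMeasurable.aemeasurable, hSmean] at hSvar
    exact hSvar
  calc _ ≤ (n : ℝ)⁻¹ ^ 2 * (n * P.real s) := by
        gcongr
        exact h1.trans h2
    _ = P.real s / n := by field_simp

end

/-! ### Expected discrepancy and the choice of scale -/

section

variable {d n : ℕ}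

lemma sum_dyadicCell_real (j : ℕ) (P : Measure (Cube d)) [IsProbabilityMeasure P] :
    ∑ A ∈ dyadicIndices d j, P.real (dyadicCell j A) = 1 := by
  have h := (integral_comp_dyadicIndex j (fun _ => 1) P).2
  simpa using h.symm

/-- Cauchy–Schwarz over the `2^(dj)` cells, whose masses sum to `1`. -/
lemma sum_sqrt_dyadicCell_real_le (j : ℕ) (P : Measure (Cube d)) [IsProbabilityMeasure P] :
    ∑ A ∈ dyadicIndices d j, √(P.real (dyadicCell j A)) ≤ √(2 ^ d) ^ j := by
  refine (sq_le_sq₀ (Finset.sum_nonneg fun _ _ => Real.sqrt_nonneg _) (by positivity)).mp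
    (sq_sum_le_card_mul_sum_sq.trans_eq ?_)
  simp only [Real.sq_sqrt measureReal_nonneg, sum_dyadicCell_real, card_dyadicIndices]
  rw [pow_right_comm (√_), Real.sq_sqrt (by positivity)]
  simp

lemma integrable_abs_empiricalMeasure_real_sub [NeZero n] {E : Type*} [MeasurableSpace E]
    (P : Measure E) [IsProbabilityMeasure P] {s : Set E} (hs : MeasurableSet s) :
    Integrable (fun x => |(empiricalMeasure x).real s - P.real s|)
      (Measure.pi fun _ : Fin n => P) := by
  refine Integrable.of_bound (C := 1) ?_ (Filter.Eventually.of_forall fun x => ?_)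
  · exact (((measurable_empiricalMeasure_real hs).sub_const _).abs).aestronglyMeasurable
  · rw [Real.norm_eq_abs, abs_abs]
    exact abs_sub_le_of_le_of_le measureReal_nonneg measureReal_le_one measureReal_nonneg
      measureReal_le_one |>.trans_eq (by simp)

lemma integrable_dyadicDiscrepancy_empiricalMeasure [NeZero n] (J : ℕ) (P : Measure (Cube d))
    [IsProbabilityMeasure P] :
    Integrable (fun x => dyadicDiscrepancy J (empiricalMeasure x) P)
      (Measure.pi fun _ : Fin n => P) :=
  integrable_finsetSum _ fun _ _ => (integrable_finsetSum _ fun A _ =>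
    integrable_abs_empiricalMeasure_real_sub P (measurableSet_dyadicCell _ A)).const_mul _

lemma integral_dyadicDiscrepancy_empiricalMeasure_le [NeZero n] (J : ℕ) (P : Measure (Cube d))
    [IsProbabilityMeasure P] :
    ∫ x, dyadicDiscrepancy J (empiricalMeasure x) P ∂(Measure.pi fun _ : Fin n => P) ≤
      (∑ j ∈ Finset.range J, (√(2 ^ d) / 2) ^ (j + 1)) / √n := by
  have hi : ∀ j, ∀ A ∈ dyadicIndices d (j + 1), Integrable
      (fun x => |(empiricalMeasure x).real (dyadicCell (j + 1) A) - P.real (dyadicCell (j + 1) A)|)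
      (Measure.pi fun _ : Fin n => P) := fun j A _ =>
    integrable_abs_empiricalMeasure_real_sub P (measurableSet_dyadicCell _ A)
  simp only [dyadicDiscrepancy]
  rw [integral_finsetSum _ fun j _ => (integrable_finsetSum _ (hi j)).const_mul _, Finset.sum_div]
  refine Finset.sum_le_sum fun j _ => ?_
  rw [integral_const_mul, integral_finsetSum _ (hi j)]
  calc _ ≤ (1 / 2 : ℝ) ^ (j + 1) *
        ∑ A ∈ dyadicIndices d (j + 1), √(P.real (dyadicCell (j + 1) A)) / √n := by
        gcongr with A _
        exact integral_abs_empiricalMeasure_real_sub_le P (measurableSet_dyadicCell _ A)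
    _ ≤ (1 / 2 : ℝ) ^ (j + 1) * (√(2 ^ d) ^ (j + 1) / √n) := by
        rw [← Finset.sum_div]
        gcongr
        exact sum_sqrt_dyadicCell_real_le _ P
    _ = (√(2 ^ d) / 2) ^ (j + 1) / √n := by
        simp only [div_pow, one_pow]; ring

/-- The last term dominates. The induction step needs `4 + a ≤ 4 * a`, which is the threshold `4 /
3`. -/
lemma sum_geometric_succ_le {a : ℝ} (ha : 4 / 3 ≤ a) (J : ℕ) :
    ∑ j ∈ Finset.range J, a ^ (j + 1) ≤ 4 * a ^ J := by
  induction J with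
  | zero => simp
  | succ J ih =>
    rw [Finset.sum_range_succ, pow_succ]
    have : 0 < a ^ J := by positivity
    nlinarith

/-- The expected multiscale bound at the scale matched to the sample size. -/
lemma exists_integral_dyadicDiscrepancy_le (hd : 2 < d) [NeZero n] (P : Measure (Cube d))
    [IsProbabilityMeasure P] :
    ∃ J : ℕ, ∫ x, (2 * (1 / 2) ^ J + dyadicDiscrepancy J (empiricalMeasure x) P)
      ∂(Measure.pi fun _ : Fin n => P) ≤ 12 * (n : ℝ) ^ (-(1 : ℝ) / (d : ℝ)) := by
  have hn : n ≠ 0 := NeZero.ne n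
  have hn0 : (0 : ℝ) < n := by exact_mod_cast Nat.pos_of_ne_zero hn
  have hb : 1 < 2 ^ d := Nat.one_lt_two_pow (by omega)
  -- The largest `J` with `2^(dJ) ≤ n`. The stochastic part is then at most `4 · 2⁻ᴶ` and the
  -- rounding part is `2 · 2⁻ᴶ`; with `2⁻ᴶ ≤ 2 n^(-1/d)` this gives `12`.
  refine ⟨Nat.log (2 ^ d) n, ?_⟩
  set J := Nat.log (2 ^ d) n
  have hlow : (2 ^ d) ^ J ≤ n := Nat.pow_log_le_self _ hn
  have hup : n < (2 ^ d) ^ (J + 1) := Nat.lt_pow_succ_log_self hb n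
  rw [integral_add (integrable_const _) (integrable_dyadicDiscrepancy_empiricalMeasure J P)]
  -- Here `d > 2` enters: the ratio is at least `√8 / 2`, whereas `d = 2` would give `1`.
  have ha : 4 / 3 ≤ √(2 ^ d) / 2 := by
    have h8 : (8 : ℝ) ≤ 2 ^ d := by
      calc (8 : ℝ) = 2 ^ 3 := by norm_num
        _ ≤ 2 ^ d := pow_le_pow_right₀ one_le_two hd
    have : 8 / 3 ≤ √(2 ^ d) := Real.le_sqrt_of_sq_le (by linarith)
    linarith
  have hsq : √(2 ^ d) ^ J ≤ √n := by
    refine Real.le_sqrt_of_sq_le ?_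
    rw [← pow_mul, mul_comm, pow_mul, Real.sq_sqrt (by positivity)]
    exact_mod_cast hlow
  have h1 : (∑ j ∈ Finset.range J, (√(2 ^ d) / 2) ^ (j + 1)) / √n ≤ 4 * (1 / 2 : ℝ) ^ J := by
    have hs : 0 < √(n : ℝ) := Real.sqrt_pos.mpr hn0
    rw [div_le_iff₀ hs]
    calc _ ≤ 4 * (√(2 ^ d) / 2) ^ J := sum_geometric_succ_le ha J
      _ = 4 * (1 / 2 : ℝ) ^ J * √(2 ^ d) ^ J := by rw [div_pow, one_div, inv_pow]; ring
      _ ≤ _ := by gcongr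
  have h2 : (1 / 2 : ℝ) ^ J ≤ 2 * (n : ℝ) ^ (-(1 : ℝ) / (d : ℝ)) := by
    have hd0 : d ≠ 0 := by omega
    have hr : (n : ℝ) ^ ((1 : ℝ) / d) ≤ 2 ^ (J + 1) := by
      rw [one_div]
      calc (n : ℝ) ^ ((d : ℝ)⁻¹) ≤ ((2 ^ (J + 1) : ℝ) ^ d) ^ ((d : ℝ)⁻¹) := by
            refine Real.rpow_le_rpow hn0.le ?_ (by positivity)
            rw [← pow_mul, mul_comm, pow_mul]
            exact_mod_cast hup.le
        _ = 2 ^ (J + 1) := Real.pow_rpow_inv_natCast (by positivity) hd0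
    have hp : 0 < (n : ℝ) ^ ((1 : ℝ) / d) := Real.rpow_pos_of_pos hn0 _
    rw [neg_div, Real.rpow_neg hn0.le, one_div, inv_pow, ← div_eq_mul_inv, le_div_iff₀ hp,
      inv_mul_le_iff₀ (by positivity)]
    rwa [pow_succ] at hr
  have h3 := integral_dyadicDiscrepancy_empiricalMeasure_le (n := n) J P
  have h4 : ∫ _, 2 * (1 / 2 : ℝ) ^ J ∂(Measure.pi fun _ : Fin n => P) = 2 * (1 / 2 : ℝ) ^ J := by
    simp
  rw [h4]
  linarith

end

/-! ### Rate for the empirical error and the oracle inequality -/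

section

variable {d D n : ℕ}

lemma integrable_ipm_empiricalMeasure {E : Type*} [MeasurableSpace E] [MetricSpace E]
    [CompactSpace E] [BorelSpace E] {F : Set (E → ℝ)} (hF : ∀ f ∈ F, LipschitzWith 1 f)
    [NeZero n] (P : Measure E) [IsProbabilityMeasure P] (ν : Measure (Fin n → E))
    [IsFiniteMeasure ν] : Integrable (fun x => ipm F (empiricalMeasure x) P) ν :=
  (continuous_ipm_empiricalMeasure hF P).integrable_of_compactSpace ν

lemma ipm_empiricalMeasure_map_le {F : Set (Cube D → ℝ)} (hF : ∀ f ∈ F, LipschitzWith 1 f)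
    {K : ℝ≥0} {g : Cube d → Cube D} (hg : LipschitzWith K g) [NeZero n] (J : ℕ)
    (ν : Measure (Cube d)) [IsProbabilityMeasure ν] (u : Fin n → Cube d) :
    ipm F (empiricalMeasure fun i => g (u i)) (ν.map g) ≤
      K * √d * (2 * (1 / 2) ^ J + dyadicDiscrepancy J (empiricalMeasure u) ν) := by
  have h := fun {φ : Cube d → ℝ} (hφ : LipschitzWith K φ) =>
    abs_integral_sub_integral_le_dyadicDiscrepancy hφ J (empiricalMeasure u) ν
  -- The zero function serves only to show that the bound is nonnegative, as needed when `F` is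
  -- empty.
  refine ipm_le ((abs_nonneg _).trans (h (LipschitzWith.const' 0))) fun f hf => ?_
  have hfg : LipschitzWith K (f ∘ g) := by simpa using (hF f hf).comp hg
  have := h hfg
  rw [integral_empiricalMeasure _ hfg.continuous.stronglyMeasurable] at this
  rw [integral_empiricalMeasure _ (hF f hf).continuous.stronglyMeasurable,
    integral_map hg.continuous.aemeasurable (hF f hf).continuous.aestronglyMeasurable]
  exact this

/-- The empirical measure of the image of a measure on `[0,1]^d` under a Lipschitz map converges
at rate `n ^ (-1/d)`. -/
lemma integral_ipm_empiricalMeasure_map_le {F : Set (Cube D → ℝ)}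
    (hF : ∀ f ∈ F, LipschitzWith 1 f) (hd : 2 < d) [NeZero n] {K : ℝ≥0} {g : Cube d → Cube D}
    (hg : LipschitzWith K g) (ν : Measure (Cube d)) [IsProbabilityMeasure ν] :
    ∫ y, ipm F (empiricalMeasure y) (ν.map g) ∂(Measure.pi fun _ : Fin n => ν.map g) ≤
      12 * K * √d * (n : ℝ) ^ (-(1 : ℝ) / (d : ℝ)) := by
  have hgm : Measurable g := hg.continuous.measurable
  have := Measure.isProbabilityMeasure_map (μ := ν) hgm.aemeasurable
  obtain ⟨J, hJ⟩ := exists_integral_dyadicDiscrepancy_le (n := n) hd ν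
  have hcont := continuous_ipm_empiricalMeasure hF (n := n) (ν.map g)
  have hmap : (Measure.pi fun _ : Fin n => ν.map g) =
      (Measure.pi fun _ : Fin n => ν).map (fun u i => g (u i)) :=
    (Measure.pi_map_pi fun _ => hgm.aemeasurable).symm
  have hgc := hg.continuous
  rw [hmap, integral_map (by fun_prop : Continuous fun (u : Fin n → Cube d) i => g (u i)
    ).aemeasurable hcont.aestronglyMeasurable]
  calc _ ≤ ∫ u, K * √d * (2 * (1 / 2) ^ J + dyadicDiscrepancy J (empiricalMeasure u) ν)
        ∂(Measure.pi fun _ : Fin n => ν) := by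
        refine integral_mono ?_ ?_ fun u => ipm_empiricalMeasure_map_le hF hg J ν u
        · exact (hcont.comp (by fun_prop : Continuous fun (u : Fin n → Cube d) i => g (u i))
            ).integrable_of_compactSpace _
        · exact ((integrable_const _).add
            (integrable_dyadicDiscrepancy_empiricalMeasure J ν)).const_mul _
    _ ≤ K * √d * (12 * (n : ℝ) ^ (-(1 : ℝ) / (d : ℝ))) := by
        rw [integral_const_mul]
        gcongr
    _ = _ := by ring

/-- Both samples are realised as the coordinates of `n` i.i.d. pairs with law `π`. The mean distance
is paid twice: between the two empirical measures, and between `Q` and `P`. -/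
lemma integral_ipm_empiricalMeasure_le_of_coupling {E : Type*} [MeasurableSpace E] [MetricSpace E]
    [CompactSpace E] [BorelSpace E] {F : Set (E → ℝ)} (hF : ∀ f ∈ F, LipschitzWith 1 f)
    [NeZero n] (P Q : Measure E) [IsProbabilityMeasure P] [IsProbabilityMeasure Q]
    {π : Measure (E × E)} [IsProbabilityMeasure π] (hπ : π ∈ couplings Q P) :
    ∫ x, ipm F (empiricalMeasure x) P ∂(Measure.pi fun _ : Fin n => P) ≤
      2 * ∫ z, dist z.1 z.2 ∂π +
        ∫ y, ipm F (empiricalMeasure y) Q ∂(Measure.pi fun _ : Fin n => Q) := by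
  have hn : (n : ℝ) ≠ 0 := by simpa using NeZero.ne n
  have hmapP : (Measure.pi fun _ : Fin n => P) =
      (Measure.pi fun _ : Fin n => π).map (fun z i => (z i).2) := by
    simp only [← hπ.2]
    exact (Measure.pi_map_pi (f := fun _ => Prod.snd) (by fun_prop)
      (hμ := fun _ => by rw [hπ.2]; infer_instance)).symm
  have hmapQ : (Measure.pi fun _ : Fin n => Q) =
      (Measure.pi fun _ : Fin n => π).map (fun z i => (z i).1) := by
    simp only [← hπ.1]
    exact (Measure.pi_map_pi (f := fun _ => Prod.fst) (by fun_prop)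
      (hμ := fun _ => by rw [hπ.1]; infer_instance)).symm
  have hcP := continuous_ipm_empiricalMeasure hF (n := n) P
  have hcQ := continuous_ipm_empiricalMeasure hF (n := n) Q
  have hiP : Integrable (fun z : Fin n → E × E => ipm F (empiricalMeasure fun i => (z i).2) P)
      (Measure.pi fun _ : Fin n => π) :=
    (hcP.comp (by fun_prop : Continuous fun (z : Fin n → E × E) i => (z i).2)
      ).integrable_of_compactSpace _
  have hiQ : Integrable (fun z : Fin n → E × E => ipm F (empiricalMeasure fun i => (z i).1) Q)
      (Measure.pi fun _ : Fin n => π) :=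
    (hcQ.comp (by fun_prop : Continuous fun (z : Fin n → E × E) i => (z i).1)
      ).integrable_of_compactSpace _
  have hid : ∀ i : Fin n, Integrable (fun z : Fin n → E × E => dist (z i).1 (z i).2)
      (Measure.pi fun _ : Fin n => π) := fun i =>
    (by fun_prop : Continuous fun z : Fin n → E × E => dist (z i).1 (z i).2
      ).integrable_of_compactSpace _
  have hsum : Integrable (fun z : Fin n → E × E => (n : ℝ)⁻¹ * ∑ i, dist (z i).1 (z i).2)
      (Measure.pi fun _ : Fin n => π) := (integrable_finsetSum _ fun i _ => hid i).const_mul _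
  have hid' : Integrable (fun z : Fin n → E × E =>
      (n : ℝ)⁻¹ * ∑ i, dist (z i).1 (z i).2 + ∫ z, dist z.1 z.2 ∂π)
      (Measure.pi fun _ : Fin n => π) := hsum.add (integrable_const _)
  have heval : ∀ i : Fin n, ∫ z : Fin n → E × E, dist (z i).1 (z i).2
      ∂(Measure.pi fun _ : Fin n => π) = ∫ z, dist z.1 z.2 ∂π := fun i =>
    integral_comp_eval (μ := fun _ : Fin n => π) (i := i) (f := fun z : E × E => dist z.1 z.2)
      (by fun_prop : Continuous fun z : E × E => dist z.1 z.2).aestronglyMeasurable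
  rw [hmapP, hmapQ, integral_map (Measurable.aemeasurable (by fun_prop)) hcP.aestronglyMeasurable,
    integral_map (Measurable.aemeasurable (by fun_prop)) hcQ.aestronglyMeasurable]
  calc _ ≤ ∫ z : Fin n → E × E, ((n : ℝ)⁻¹ * ∑ i, dist (z i).1 (z i).2 +
          ∫ z, dist z.1 z.2 ∂π + ipm F (empiricalMeasure fun i => (z i).1) Q)
        ∂(Measure.pi fun _ : Fin n => π) := by
        refine integral_mono hiP (hid'.add hiQ) fun z => ?_
        have h1 := ipm_empiricalMeasure_le hF (fun i => (z i).2) (fun i => (z i).1)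
        simp only [dist_comm (z _).2] at h1
        have h2 := ipm_triangle hF (empiricalMeasure fun i => (z i).2)
          (empiricalMeasure fun i => (z i).1) P
        have h3 := ipm_triangle hF (empiricalMeasure fun i => (z i).1) Q P
        have h4 := ipm_le_integral_dist hF hπ
        dsimp only
        linarith
    _ = _ := by
        rw [integral_add hid' hiQ, integral_add hsum (integrable_const _),
          integral_const_mul, integral_finsetSum _ fun i _ => hid i]
        simp only [heval, Finset.sum_const, Finset.card_univ, Fintype.card_fin, nsmul_eq_mul,
          integral_const, probReal_univ, one_smul]
        field_simp
        ring

lemma integral_ipm_empiricalMeasure_le_of_assumptionA {F : Set (Cube D → ℝ)}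
    (hF : ∀ f ∈ F, LipschitzWith 1 f) (hd : 2 < d) [NeZero n] {P : Measure (Cube D)}
    [IsProbabilityMeasure P] {K σ : ℝ≥0} (hP : AssumptionA d K σ P) :
    ∫ x, ipm F (empiricalMeasure x) P ∂(Measure.pi fun _ : Fin n => P) ≤
      2 * σ + 12 * K * √d * (n : ℝ) ^ (-(1 : ℝ) / (d : ℝ)) := by
  obtain ⟨g, hg, hW⟩ := hP
  have := Measure.isProbabilityMeasure_map (μ := uniformCube d) hg.continuous.aemeasurable
  -- The slack avoids the need for an optimal coupling; it is halved below because the coupling cost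
  -- is counted twice.
  refine le_of_forall_pos_le_add fun ε hε => ?_
  have hlt : wasserstein1 ((uniformCube d).map g) P < ENNReal.ofReal (σ + ε / 2) := by
    refine hW.trans_lt ?_
    rw [← ENNReal.ofReal_coe_nnreal]
    exact (ENNReal.ofReal_lt_ofReal_iff (by positivity)).mpr (by linarith)
  obtain ⟨π, hπ, hlt⟩ : ∃ π ∈ couplings ((uniformCube d).map g) P,
      ∫⁻ z, edist z.1 z.2 ∂π < ENNReal.ofReal (σ + ε / 2) := by
    simpa only [wasserstein1, iInf_lt_iff, exists_prop] using hlt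
  have hprob : IsProbabilityMeasure π := by
    have : IsProbabilityMeasure (π.map Prod.snd) := by rw [hπ.2]; infer_instance
    exact Measure.isProbabilityMeasure_of_map Prod.snd
  have hdist : ∫ z, dist z.1 z.2 ∂π ≤ σ + ε / 2 := by
    rw [integral_eq_lintegral_of_nonneg_ae (Filter.Eventually.of_forall fun _ => dist_nonneg)
      (by fun_prop : Continuous fun z : Cube D × Cube D => dist z.1 z.2).aestronglyMeasurable]
    refine ENNReal.toReal_le_of_le_ofReal (by positivity) ?_
    simpa only [← edist_dist] using hlt.le
  have h1 := integral_ipm_empiricalMeasure_le_of_coupling hF (n := n) P _ hπ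
  have h2 := integral_ipm_empiricalMeasure_map_le hF hd (n := n) hg (uniformCube d)
  linarith

/-- Pass from `P` to the empirical measure for `ghat`, use minimality, and pass back for `g`. The
penalty is the same for both targets, so only the two `ipm` passages cost anything. -/
lemma ipm_le_penalizedRisk_add {F : Set (Cube D → ℝ)} (hF : ∀ f ∈ F, LipschitzWith 1 f)
    {q lam : ℝ} (hlam : 0 ≤ lam) {G : Set (Cube d → Cube D)} (hG : ∀ g ∈ G, Continuous g)
    {H : Set (Cube D → Cube d)} [NeZero n] {P : Measure (Cube D)} [IsProbabilityMeasure P]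
    {x : Fin n → Cube D} {ghat : Cube d → Cube D} (hghat : IsLIPERM q lam F G H x ghat)
    {g : Cube d → Cube D} (hg : g ∈ G) :
    ipm F ((uniformCube d).map ghat) P ≤
      penalizedRisk q lam F H P g + 2 * ipm F (empiricalMeasure x) P := by
  have := Measure.isProbabilityMeasure_map (μ := uniformCube d) (hG g hg).aemeasurable
  have := Measure.isProbabilityMeasure_map (μ := uniformCube d) (hG ghat hghat.1).aemeasurable
  have hmin : penalizedRisk q lam F H (empiricalMeasure x) ghat ≤
      penalizedRisk q lam F H (empiricalMeasure x) g := hghat.2 hg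
  have hpen : 0 ≤ lam * leftInvPenalty q H ghat :=
    mul_nonneg hlam (Real.iInf_nonneg fun _ => integral_nonneg fun _ =>
      Real.rpow_nonneg (norm_nonneg _) _)
  have h1 := ipm_triangle hF ((uniformCube d).map ghat) (empiricalMeasure x) P
  have h2 := ipm_triangle hF ((uniformCube d).map g) P (empiricalMeasure x)
  have h3 : ipm F P (empiricalMeasure x) = ipm F (empiricalMeasure x) P := by
    simp only [ipm, abs_sub_comm]
  simp only [penalizedRisk] at hmin ⊢
  linarith

end

end

theorem theorem1 :
    ∃ c : ℝ, 0 < c ∧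
      ∀ (d D n : ℕ), 2 < d → 1 ≤ n →
      ∀ (F : Set (Cube D → ℝ)), (∀ f ∈ F, LipschitzWith 1 f) →
      ∀ (L_G L_H : ℝ≥0)
        (G : Set (Cube d → Cube D)), (∀ g ∈ G, LipschitzWith L_G g) →
      ∀ (H : Set (Cube D → Cube d)), H.Nonempty → (∀ h ∈ H, LipschitzWith L_H h) →
      ∀ (q lam : ℝ), 1 ≤ q → 0 < lam →
      ∀ (Pstar : Measure (Cube D)) [IsProbabilityMeasure Pstar]
        (Lstar σstar : ℝ≥0), AssumptionA d Lstar σstar Pstar →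
      ∀ (Ω : Type*) [MeasurableSpace Ω] (μ : Measure Ω) [IsProbabilityMeasure μ]
        (X : Fin n → Ω → Cube D), iIndepFun X μ → (∀ i, HasLaw (X i) Pstar μ) →
      ∀ (ghat : Ω → Cube d → Cube D),
        (∀ᵐ ω ∂μ, IsLIPERM q lam F G H (fun i => X i ω) (ghat ω)) →
        AEMeasurable (fun ω => ipm F ((uniformCube d).map (ghat ω)) Pstar) μ →
      Integrable (fun ω => ipm F ((uniformCube d).map (ghat ω)) Pstar) μ ∧
      ∫ ω, ipm F ((uniformCube d).map (ghat ω)) Pstar ∂μ ≤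
        (⨅ g : G, penalizedRisk q lam F H Pstar g.1) + 4 * (σstar : ℝ)
          + c * (Lstar : ℝ) * √(d : ℝ) * (n : ℝ) ^ (-(1 : ℝ) / (d : ℝ)) := by
  -- The empirical error enters twice, so `12` becomes `24` and `2σ` becomes `4σ`.
  refine ⟨24, by norm_num, ?_⟩
  intro d D n hd hn F hF L_G L_H G hG H _ _ q lam _ hlam Pstar _ Lstar σstar hA Ω _ μ _ X hXi hXl
    ghat hmin hmeas
  have : NeZero n := ⟨by omega⟩
  have hGc : ∀ g ∈ G, Continuous g := fun g hg => (hG g hg).continuous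
  have hint : Integrable (fun ω => ipm F ((uniformCube d).map (ghat ω)) Pstar) μ := by
    refine Integrable.of_bound (C := Metric.diam (Set.univ : Set (Cube D)))
      hmeas.aestronglyMeasurable ?_
    filter_upwards [hmin] with ω hω
    have := Measure.isProbabilityMeasure_map (μ := uniformCube d) (hGc _ hω.1).aemeasurable
    rw [Real.norm_of_nonneg (ipm_nonneg _ _ _)]
    exact ipm_le_diam hF _ _
  refine ⟨hint, ?_⟩
  -- An almost sure event of a probability measure is nonempty, so `G` contains a minimizer; this
  -- excludes the default value `0` of a real infimum over an empty type.
  obtain ⟨ω₀, hω₀⟩ := hmin.exists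
  have : Nonempty G := ⟨⟨ghat ω₀, hω₀.1⟩⟩
  rw [add_assoc, ← sub_le_iff_le_add]
  refine le_ciInf fun g => ?_
  rw [sub_le_iff_le_add]
  have hlaw : HasLaw (fun ω i => X i ω) (Measure.pi fun _ : Fin n => Pstar) μ :=
    iIndepFun.hasLaw_pi hXl hXi
  have hemp : ∫ ω, ipm F (empiricalMeasure fun i => X i ω) Pstar ∂μ =
      ∫ x, ipm F (empiricalMeasure x) Pstar ∂(Measure.pi fun _ : Fin n => Pstar) := by
    rw [← hlaw.map_eq, integral_map hlaw.aemeasurable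
      (continuous_ipm_empiricalMeasure hF Pstar).aestronglyMeasurable]
  have hiemp : Integrable (fun ω => ipm F (empiricalMeasure fun i => X i ω) Pstar) μ :=
    Integrable.comp_aemeasurable (f := fun ω i => X i ω)
      (g := fun x => ipm F (empiricalMeasure x) Pstar)
      (by rw [hlaw.map_eq]; exact integrable_ipm_empiricalMeasure hF Pstar _) hlaw.aemeasurable
  have hle : ∫ ω, ipm F ((uniformCube d).map (ghat ω)) Pstar ∂μ ≤
      ∫ ω, (penalizedRisk q lam F H Pstar g.1 +
        2 * ipm F (empiricalMeasure fun i => X i ω) Pstar) ∂μ := by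
    refine integral_mono_ae hint ((integrable_const _).add (hiemp.const_mul 2)) ?_
    filter_upwards [hmin] with ω hω
    exact ipm_le_penalizedRisk_add hF hlam.le hGc hω g.2
  rw [integral_add (integrable_const _) (hiemp.const_mul 2), integral_const_mul, hemp] at hle
  have hrate := integral_ipm_empiricalMeasure_le_of_assumptionA hF hd (n := n) hA
  simp only [integral_const, probReal_univ, one_smul] at hle
  linarith
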